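/- Let $C$ be a smooth, projective, geometrically connected curve over a finite field $\mathbb F_q$ with function field $K$, let $\infty$ be a closed point of $C$ of degree $d_\infty$, and let $A\subset K$ be the ring of functions regular outside $\infty$. Let $L$ be an $A$-field of generic characteristic, i.e. a field with an injective ring homomorphism $A\to L$ (for example a complete subfield of $\mathbf C_\infty$ containing $K_\infty$), let $\overline L$ be an algebraic closure of $L$, and let $n\in\mathbb N$. Let $L\{\tau\}$ be the ring of twisted polynomials, $\tau a=a^q\tau$. A Drinfeld $A$-module of rank $n$ over $L$ is a homomorphism of $\mathbb F_q$-algebras $\Phi:A\to L\{\tau\}$, $a\mapsto\Phi_a$, such that the constant coefficient of $\Phi_a$ is the image of $a$ in $L$ for all $a$, $\Phi_a$ is not constant for some $a$, and $\deg_\tau\Phi_a=n\deg a=-n\,d_\infty v_\infty(a)$ for all $a\ne0$. We write $\Phi(\overline L)$ for $\overline L$ with the $A$-module structure given by $\Phi$. For $v$ a place of $K$ other than $\infty$, let $K_v$, $A_v$ be the $v$-adic completions of $K$, $A$, let $\Phi[v^\infty]\subset\Phi(\overline L)$ be the union of the submodules $\Phi[v^m]$, $m\ge1$, and let $T_v\Phi=\mathrm{Hom}_A(K_v/A_v,\Phi[v^\infty])$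 and $T\Phi=\prod_{v\neq\infty}T_v\Phi$. An isogeny $P:\Phi\to\Psi$ is a nonzero $P\in L\{\tau\}$ with $P\Phi_a=\Psi_aP$ for all $a\in A$; it induces maps $P:\Phi(\overline L)\to\Psi(\overline L)$ and $T_v(P):T_v\Phi\to T_v\Psi$. An $n$-pointed Drinfeld module over $L$ is a datum $(\Phi,\zeta_1,\dots,\zeta_n)$ with $\Phi$ a Drinfeld $A$-module of rank $n$ over $L$ and $\zeta_i\in T\Phi$. Commensurability is the equivalence relation generated by $(\Phi,\zeta_i)\to(\Psi,\eta_i)$ whenever there is an isogeny $P:\Phi\to\Psi$ with $(\eta_i)_v=T_v(P)(\zeta_i)_v$ for all $i$ and $v$; let $\mathcal D_{K,n}^{L}$ be the set of commensurability classes. A Drinfeld module with possibly degenerate level structure is a datum $(\Phi,\rho)$ with $\Phi$ a Drinfeld $A$-module of rank $n$ over $L$ and $\rho:(K/A)^n\to\Phi(\overline L)$ an arbitrary homomorphism of $A$-modules; isogeny of such data is the equivalence relation generated by $(\Phi,\rho)\to(\Psi,P\circ\rho)$ for isogenies $P:\Phi\to\Psi$. **Corollary 2.6.** Send $(\Phi,\zeta_1,\dots,\zeta_n)$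 to $(\Phi,\rho)$ with $$\rho(x_1,\dots,x_n)=\sum_{i=1}^n\sum_{v\ne\infty}(\zeta_i)_v(x_{i,v}),$$ where $x_{i,v}$ is the image of $x_i\in K/A$ in $K_v/A_v$ (zero for almost all $v$). This is a bijection from the set of $n$-pointed Drinfeld modules over $L$ to the set of Drinfeld modules of rank $n$ over $L$ with possibly degenerate level structure. There is an isogeny $P$ relating two $n$-pointed Drinfeld modules as above if and only if there is an isogeny relating their images as above. Hence the map induces a bijection from $\mathcal D_{K,n}^{L}$ to the set of isogeny classes of data $(\Phi,\rho)$. In particular, if $L$ is algebraically closed, $\rho$ is a homomorphism $(K/A)^n\to\Phi(L)$. -/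

import Mathlib

open IsDedekindDomain
open scoped WithZero

namespace Drinfeld

noncomputable section

/-! ### The function field, its places and the ring of functions regular outside `∞` -/

/-- `K` is the function field of a smooth, projective, geometrically connected curve over the finite
field `k`: it is a finite extension of some `k(t)` with `t` transcendental over `k`, and `k` is
algebraically closed in `K` (the full constant field). -/
structure IsCurveFunctionField (k K : Type*) [Field k] [Field K] [Algebra k K] : Prop where
  finite_over_rational : ∃ t : K, Transcendental k t ∧
    FiniteDimensional (IntermediateField.adjoin k ({t} : Set K)) K
  constants : ∀ x : K, IsAlgebraic k x → x ∈ (algebraMap k K).range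

/-- A place of `K` (a closed point of the curve), given by its normalized discrete valuation,
written multiplicatively. Triviality on the finite field of constants is automatic. -/
@[ext]
structure Place (K : Type*) [Field K] where
  valuation : Valuation K ℤᵐ⁰
  surjective : Function.Surjective valuation

namespace Place

variable {K : Type*} [Field K] (w : Place K)

/-- The additive normalized valuation of a nonzero element (with the junk value `0` at `0`). -/
def ord (x : K) : ℤ := -WithZero.log (w.valuation x)

variable (k : Type*) [Field k] [Finite k] [Algebra k K]

/-- The constants are integral at every place. -/
@[reducible]
def algebraValuationSubring : Algebra k w.valuation.valuationSubring :=
  ((algebraMap k K).codRestrict w.valuation.valuationSubring.toSubring fun a => by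
    have h := Valuation.IsTrivialOn.valuation_algebraMap_le_one w.valuation a
    exact (Valuation.mem_valuationSubring_iff _ _).2 h).toAlgebra

/-- The degree over `k` of the residue field at the place `w`. -/
def degree : ℕ :=
  letI := w.algebraValuationSubring k
  Module.finrank k (IsLocalRing.ResidueField w.valuation.valuationSubring)

/-- `deg x = - d_w * v_w (x)` for a nonzero element `x`. -/
def deg (x : K) : ℤ := -((w.degree k : ℤ) * w.ord x)

end Place

/-- `A` (embedded in `K`) consists of exactly those elements of `K` that are regular at every
place other than `pt`. -/
def IsRegularOutside {K : Type*} [Field K] (pt : Place K)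
    (A : Type*) [CommRing A] [Algebra A K] : Prop :=
  ∀ x : K, x ∈ (algebraMap A K).range ↔ ∀ w : Place K, w ≠ pt → w.valuation x ≤ 1

/-! ### The twisted polynomial ring `F{τ}` -/

section Twisted

variable (k F : Type*) [Field k] [Fintype k] [Field F] [Algebra k F]

/-- `i : ℕ` acts on `F` by the `i`-th power of the `q`-Frobenius `a ↦ a ^ q`, `q = #k`. -/
@[reducible]
def frobeniusAction : MulSemiringAction (Multiplicative ℕ) F :=
  MulSemiringAction.compHom F
    (powersHom (F →+* F) (FiniteField.frobeniusAlgHom k F : F →+* F))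

/-- The ring `F{τ}` of twisted polynomials `∑ aᵢ τ ^ i`, with `τ a = a ^ q τ`, `q = #k`. -/
def TwistedPolynomial (_k F : Type*) [Field F] : Type _ := SkewPolynomial F

instance : Ring (TwistedPolynomial k F) :=
  letI := frobeniusAction k F
  inferInstanceAs (Ring (SkewMonoidAlgebra F (Multiplicative ℕ)))

end Twisted

namespace TwistedPolynomial

variable {k F : Type*} [Field k] [Fintype k] [Field F] [Algebra k F]

/-- The coefficient of `τ ^ i`. -/
def coeff (f : TwistedPolynomial k F) (i : ℕ) : F := SkewPolynomial.coeff f i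

/-- The monomial `a τ ^ i`. -/
def monomial (k : Type*) {F : Type*} [Field F] (i : ℕ) (a : F) : TwistedPolynomial k F :=
  SkewPolynomial.monomial i a

/-- The degree in `τ` (with value `0` for the zero polynomial). -/
def natDegree (f : TwistedPolynomial k F) : ℕ := (SkewPolynomial.support f).sup id

theorem monomial_mul_monomial (i j : ℕ) (a b : F) :
    monomial k i a * monomial k j b = monomial k (i + j) (a * b ^ Fintype.card k ^ i) := by
  let := frobeniusAction k F
  have h : (Multiplicative.ofAdd i) • b = b ^ Fintype.card k ^ i := by
    change (powersHom (F →+* F) (FiniteField.frobeniusAlgHom k F : F →+* F)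
      (Multiplicative.ofAdd i)) b = _
    rw [powersHom_apply, toAdd_ofAdd, RingHom.coe_pow]
    change (FiniteField.frobeniusAlgHom k F)^[i] b = _
    rw [FiniteField.coe_frobeniusAlgHom, pow_iterate]
  have := SkewPolynomial.monomial_mul_monomial (R := F) i j a b
  rw [SkewPolynomial.φ_iterate_apply, h] at this
  exact this

section Eval

variable (Ω : Type*) [Field Ω] [Algebra k Ω] [Algebra F Ω]

/-- The `q`-power map on `Ω` as an additive endomorphism. -/
def frobeniusEnd (k Ω : Type*) [Field k] [Fintype k] [Field Ω] [Algebra k Ω] :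
    AddMonoid.End Ω :=
  ((FiniteField.frobeniusAlgHom k Ω : Ω →+* Ω) : Ω →+ Ω)

theorem frobeniusEnd_pow_apply (i : ℕ) (x : Ω) :
    (frobeniusEnd k Ω ^ i) x = x ^ Fintype.card k ^ i := by
  induction i generalizing x with
  | zero => simp
  | succ i ih =>
    rw [pow_succ]
    change (frobeniusEnd k Ω ^ i) (frobeniusEnd k Ω x) = _
    rw [ih]
    change (x ^ Fintype.card k) ^ _ = _
    rw [← pow_mul, pow_succ']

/-- A twisted polynomial acts on `Ω` as an additive endomorphism, `τ` acting as `x ↦ x ^ q`; the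
multiplication of `F{τ}` corresponds to composition. -/
def evalHom : TwistedPolynomial k F →+* AddMonoid.End Ω :=
  letI := frobeniusAction k F
  SkewMonoidAlgebra.liftNCRingHom (Module.toAddMonoidEnd F Ω)
    (powersHom (AddMonoid.End Ω) (frobeniusEnd k Ω)) (by
      intro a m
      ext x
      obtain ⟨i, rfl⟩ := Multiplicative.ofAdd.surjective m
      have h : (Multiplicative.ofAdd i) • a = a ^ Fintype.card k ^ i := by
        change (powersHom (F →+* F) (FiniteField.frobeniusAlgHom k F : F →+* F)
          (Multiplicative.ofAdd i)) a = _
        rw [powersHom_apply, toAdd_ofAdd, RingHom.coe_pow]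
        change (FiniteField.frobeniusAlgHom k F)^[i] a = _
        rw [FiniteField.coe_frobeniusAlgHom, pow_iterate]
      rw [h]
      change a ^ Fintype.card k ^ i • (frobeniusEnd k Ω ^ i) x
        = (frobeniusEnd k Ω ^ i) (a • x)
      rw [frobeniusEnd_pow_apply, frobeniusEnd_pow_apply, smul_pow])

theorem evalHom_monomial (i : ℕ) (a : F) (x : Ω) :
    evalHom Ω (monomial k i a) x = algebraMap F Ω a * x ^ Fintype.card k ^ i := by
  refine (DFunLike.congr_fun (SkewMonoidAlgebra.liftNC_single
    ((Module.toAddMonoidEnd F Ω : F →+* AddMonoid.End Ω) : F →+ AddMonoid.End Ω)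
    (powersHom (AddMonoid.End Ω) (frobeniusEnd k Ω)) (Multiplicative.ofAdd i) a) x).trans ?_
  change a • (frobeniusEnd k Ω ^ i) x = _
  rw [frobeniusEnd_pow_apply, Algebra.smul_def]

end Eval

end TwistedPolynomial

open TwistedPolynomial

/-! ### Drinfeld modules -/

section DrinfeldModules

variable (k : Type*) [Field k] [Fintype k]
  {K : Type*} [Field K] [Algebra k K] (pt : Place K)
  (A : Type*) [CommRing A] [Algebra k A] [Algebra A K]
  (F : Type*) [Field F] [Algebra k F] [Algebra A F]

/-- A Drinfeld `A`-module of rank `n` over the `A`-field `F`: a homomorphism of `k`-algebras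
`Φ : A → F{τ}`, `a ↦ Φ_a`, such that the constant coefficient of `Φ_a` is the image of `a`
in `F`, `Φ_a` is not the constant `a` for some `a`, and `deg Φ_a = n deg a`. -/
@[ext]
structure DrinfeldModule (n : ℕ) where
  toRingHom : A →+* TwistedPolynomial k F
  map_const : ∀ c : k, toRingHom (algebraMap k A c) = monomial k 0 (algebraMap k F c)
  coeff_zero : ∀ a : A, (toRingHom a).coeff 0 = algebraMap A F a
  nontrivial : ∃ a : A, toRingHom a ≠ monomial k 0 (algebraMap A F a)
  natDegree_eq : ∀ a : A, a ≠ 0 →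
    ((toRingHom a).natDegree : ℤ) = n * pt.deg k (algebraMap A K a)

variable {k pt A F} {n : ℕ}

namespace DrinfeldModule

/-- The `A`-module `Φ(Ω)`: the additive group of the extension field `Ω` of `F`, on which `a ∈ A`
acts through `Φ_a`. -/
def Points (_Φ : DrinfeldModule k pt A F n) (Ω : Type*) : Type _ := Ω

variable (Φ Ψ Θ : DrinfeldModule k pt A F n)
  (Ω : Type*) [Field Ω] [Algebra k Ω] [Algebra F Ω]

instance : AddCommGroup (Φ.Points Ω) := inferInstanceAs (AddCommGroup Ω)

instance : Module A (Φ.Points Ω) :=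
  Module.compHom Ω ((evalHom (k := k) (F := F) Ω).comp Φ.toRingHom)

/-- The torsion submodule `Φ[I]` for an ideal `I`: the common zeros of the `Φ_a`, `a ∈ I`. -/
def torsion (I : Ideal A) : Submodule A (Φ.Points Ω) :=
  Submodule.torsionBySet A (Φ.Points Ω) (I : Set A)

/-- `Φ[v^∞]`, the union over `m ≥ 1` of the torsion submodules `Φ[v^m]`. -/
def primaryTorsion (v : HeightOneSpectrum A) : Submodule A (Φ.Points Ω) where
  carrier := {x | ∃ m : ℕ, 1 ≤ m ∧ x ∈ Φ.torsion Ω (v.asIdeal ^ m)}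
  zero_mem' := ⟨1, le_rfl, zero_mem _⟩
  add_mem' := by
    rintro x y ⟨m, hm, hx⟩ ⟨m', _, hy⟩
    refine ⟨m + m', by omega, add_mem ?_ ?_⟩
    · exact Submodule.torsionBySet_le_torsionBySet_pow m (m + m') (by omega) v.asIdeal hx
    · exact Submodule.torsionBySet_le_torsionBySet_pow m' (m + m') (by omega) v.asIdeal hy
  smul_mem' := by
    rintro a x ⟨m, hm, hx⟩
    exact ⟨m, hm, Submodule.smul_mem _ a hx⟩

variable {Φ Ψ Θ}

/-- An isogeny `Φ → Ψ`: a nonzero `P ∈ F{τ}` with `P Φ_a = Ψ_a P` for all `a ∈ A`. -/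
structure Isogeny (Φ Ψ : DrinfeldModule k pt A F n) where
  poly : TwistedPolynomial k F
  ne_zero : poly ≠ 0
  comm : ∀ a : A, poly * Φ.toRingHom a = Ψ.toRingHom a * poly

namespace Isogeny

/-- The map `Φ(Ω) → Ψ(Ω)` induced by an isogeny. -/
def onPoints (P : Isogeny Φ Ψ) : Φ.Points Ω →ₗ[A] Ψ.Points Ω where
  toFun := (evalHom Ω P.poly : AddMonoid.End Ω)
  map_add' := fun x y => map_add (evalHom Ω P.poly : AddMonoid.End Ω) x y
  map_smul' := fun a x => by
    have h := congrArg (fun f => (evalHom Ω f : AddMonoid.End Ω) x) (P.comm a)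
    simp only [map_mul] at h
    exact h

/-- The map `Φ[v^∞] → Ψ[v^∞]` induced by an isogeny. -/
def onPrimaryTorsion (P : Isogeny Φ Ψ) (v : HeightOneSpectrum A) :
    Φ.primaryTorsion Ω v →ₗ[A] Ψ.primaryTorsion Ω v :=
  (P.onPoints Ω).restrict (by
    rintro x ⟨m, hm, hx⟩
    refine ⟨m, hm, ?_⟩
    rw [torsion, Submodule.mem_torsionBySet_iff] at hx ⊢
    intro a
    rw [← map_smul, hx a, map_zero])

end Isogeny

end DrinfeldModule

end DrinfeldModules

/-! ### Local quotients and Tate modules -/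

section Local

variable (A : Type*) [CommRing A] [IsDedekindDomain A]
  (K : Type*) [Field K] [Algebra A K] [IsFractionRing A K]

/-- The `A`-submodule `A` of `K`. -/
def integers : Submodule A K := LinearMap.range (Algebra.linearMap A K)

variable {A}

/-- The `A`-submodule `A_v` of `K_v`. -/
def localIntegers (v : HeightOneSpectrum A) : Submodule A (v.adicCompletion K) where
  carrier := {x | x ∈ v.adicCompletionIntegers K}
  zero_mem' := zero_mem (v.adicCompletionIntegers K)
  add_mem' := fun {x y} hx hy => (v.adicCompletionIntegers K).add_mem x y hx hy
  smul_mem' := fun a x hx => by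
    have h := (a • (⟨x, hx⟩ : v.adicCompletionIntegers K)).2
    rwa [HeightOneSpectrum.coe_smul_adicCompletionIntegers] at h

/-- The natural map `K/A → K_v/A_v`. -/
def localPart (v : HeightOneSpectrum A) :
    (K ⧸ integers A K) →ₗ[A] (v.adicCompletion K ⧸ localIntegers K v) :=
  Submodule.mapQ _ _ ((Algebra.linearMap K (v.adicCompletion K)).restrictScalars A) (by
    rintro _ ⟨a, rfl⟩
    change algebraMap K (v.adicCompletion K) (algebraMap A K a) ∈ v.adicCompletionIntegers K
    rw [HeightOneSpectrum.algebraMap_adicCompletion]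
    exact HeightOneSpectrum.coe_algebraMap_mem A K v a)

/-- An element of `K/A` has only finitely many nonzero local parts. -/
theorem localPart_finite (x : K ⧸ integers A K) :
    {v : HeightOneSpectrum A | localPart K v x ≠ 0}.Finite := by
  obtain ⟨y, rfl⟩ := Submodule.Quotient.mk_surjective _ x
  refine (HeightOneSpectrum.Support.finite A y).subset fun v hv => ?_
  by_contra h
  refine hv ((Submodule.Quotient.mk_eq_zero _).2 ?_)
  change algebraMap K (v.adicCompletion K) y ∈ v.adicCompletionIntegers K
  rw [HeightOneSpectrum.algebraMap_adicCompletion, Function.comp_apply, Algebra.algebraMap_self,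
    RingHom.id_apply, HeightOneSpectrum.mem_adicCompletionIntegers,
    HeightOneSpectrum.valuedAdicCompletion_eq_valuation']
  exact not_lt.1 h

end Local

section Moduli

variable {k : Type*} [Field k] [Fintype k]
  {K : Type*} [Field K] [Algebra k K] {pt : Place K}
  {A : Type*} [CommRing A] [IsDedekindDomain A] [Algebra k A] [Algebra A K] [IsFractionRing A K]
  {F : Type*} [Field F] [Algebra k F] [Algebra A F] {n : ℕ}
  (Ω : Type*) [Field Ω] [Algebra k Ω] [Algebra F Ω]

/-- The `v`-adic Tate module `T_v Φ = Hom_A (K_v/A_v, Φ[v^∞])`. -/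
abbrev TateModule (Φ : DrinfeldModule k pt A F n) (v : HeightOneSpectrum A) : Type _ :=
  (v.adicCompletion K ⧸ localIntegers K v) →ₗ[A] Φ.primaryTorsion Ω v

/-- The adelic Tate module `T Φ = ∏_v T_v Φ`, over the places `v ≠ ∞`. -/
abbrev AdelicTateModule (Φ : DrinfeldModule k pt A F n) : Type _ :=
  ∀ v : HeightOneSpectrum A, TateModule Ω Φ v

/-- The map `T_v Φ → T_v Ψ` induced by an isogeny. -/
def DrinfeldModule.Isogeny.onTate {Φ Ψ : DrinfeldModule k pt A F n}
    (P : DrinfeldModule.Isogeny Φ Ψ) (v : HeightOneSpectrum A) :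
    TateModule Ω Φ v → TateModule Ω Ψ v :=
  fun ζ => (P.onPrimaryTorsion Ω v).comp ζ

variable (k pt A F n)

/-- An `n`-pointed Drinfeld `A`-module over `F`: a Drinfeld module of rank `n` with `n` points of
its adelic Tate module. -/
structure PointedDrinfeldModule where
  module : DrinfeldModule k pt A F n
  point : Fin n → AdelicTateModule Ω module

/-- A Drinfeld module `Φ` of rank `n` with a possibly degenerate level structure: a homomorphism
of `A`-modules `ρ : (K/A)^n → Φ(Ω)`. -/
structure LevelDrinfeldModule where
  module : DrinfeldModule k pt A F n
  level : (Fin n → K ⧸ integers A K) →ₗ[A] module.Points Ω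

variable {k pt A F n Ω}

/-- `(Φ, ζ)` and `(Ψ, η)` are related by an isogeny `P : Φ → Ψ` if
`(η_i)_v = T_v(P) (ζ_i)_v` for all `i` and `v`. -/
def PointedDrinfeldModule.Related (X Y : PointedDrinfeldModule k pt A F n Ω) : Prop :=
  ∃ P : DrinfeldModule.Isogeny X.module Y.module,
    ∀ (i : Fin n) (v : HeightOneSpectrum A), Y.point i v = P.onTate Ω v (X.point i v)

/-- `(Φ, ρ)` and `(Ψ, σ)` are related by an isogeny `P : Φ → Ψ` if `σ = P ∘ ρ`. -/
def LevelDrinfeldModule.Related (X Y : LevelDrinfeldModule k pt A F n Ω) : Prop :=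
  ∃ P : DrinfeldModule.Isogeny X.module Y.module, Y.level = (P.onPoints Ω).comp X.level

variable (k pt A F n Ω)

/-- The set of commensurability classes of `n`-pointed Drinfeld modules: the quotient by the
equivalence relation generated by isogenies. -/
def CommensurabilityClasses : Type _ :=
  Quotient (Relation.EqvGen.setoid
    (PointedDrinfeldModule.Related (k := k) (pt := pt) (A := A) (F := F) (n := n) (Ω := Ω)))

/-- The set of isogeny classes of Drinfeld modules with possibly degenerate level structure: the
quotient by the equivalence relation generated by isogenies. -/
def LevelIsogenyClasses : Type _ :=
  Quotient (Relation.EqvGen.setoid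
    (LevelDrinfeldModule.Related (k := k) (pt := pt) (A := A) (F := F) (n := n) (Ω := Ω)))

variable {k pt A F n Ω}

/-- The commensurability class of an `n`-pointed Drinfeld module. -/
def PointedDrinfeldModule.toClass (X : PointedDrinfeldModule k pt A F n Ω) :
    CommensurabilityClasses k pt A F n Ω :=
  Quotient.mk _ X

/-- The isogeny class of a Drinfeld module with level structure. -/
def LevelDrinfeldModule.toClass (X : LevelDrinfeldModule k pt A F n Ω) :
    LevelIsogenyClasses k pt A F n Ω :=
  Quotient.mk _ X

/-- A point `ζ` of the adelic Tate module gives the homomorphism `K/A → Φ(Ω)` that sends `x` to the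
(finite) sum over `v` of the values of `ζ_v` at the image of `x` in `K_v/A_v`. -/
def AdelicTateModule.toHom {Φ : DrinfeldModule k pt A F n} (ζ : AdelicTateModule Ω Φ) :
    (K ⧸ integers A K) →ₗ[A] Φ.Points Ω where
  toFun x := ∑ᶠ v : HeightOneSpectrum A, (ζ v (localPart K v x) : Φ.Points Ω)
  map_add' x y := by
    rw [← finsum_add_distrib]
    · exact finsum_congr fun v => by simp
    · exact (localPart_finite K x).subset fun v hv h => hv (by simp [h])
    · exact (localPart_finite K y).subset fun v hv h => hv (by simp [h])
  map_smul' a x := by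
    rw [RingHom.id_apply, smul_finsum' a
      ((localPart_finite K x).subset fun v hv h => hv (by simp [h]))]
    exact finsum_congr fun v => by simp

/-- The datum `(Φ, ρ)` determined by `(Φ, ζ_1, …, ζ_n)`: `ρ (x_1, …, x_n) = ∑ i, ζ_i (x_i)`. -/
def PointedDrinfeldModule.toLevel (X : PointedDrinfeldModule k pt A F n Ω) :
    LevelDrinfeldModule k pt A F n Ω where
  module := X.module
  level := ∑ i : Fin n, (AdelicTateModule.toHom (X.point i)).comp (LinearMap.proj i)

end Moduli

end

end Drinfeld

/-! The quotient `K/A` is a torsion module over the Dedekind domain `A`, hence the direct sum of its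
`v`-primary parts. The natural map to `K_v/A_v` kills the `w`-primary part for `w ≠ v` and is an
isomorphism on the `v`-primary part (`localPart_powerTorsion_bijective`). A homomorphism `K/A →
Φ(Ω)` carries `v`-primary torsion into `Φ[v^∞]`, so it amounts to an arbitrary family of maps
`K_v/A_v → Φ[v^∞]`. This gives `Hom_A(K/A, Φ(Ω)) = ∏_v T_v Φ` (`AdelicTateModule.toHom_bijective`),
and `n` copies give the bijection on data. An isogeny is `A`-linear on points, so composing with it
commutes with forming the finite sum over `v` (`AdelicTateModule.toHom_onTate`). The same `P`
therefore relates two pointed modules and their images, and the generated equivalence relations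
correspond. -/

namespace Drinfeld

noncomputable section

/-! ### Primary decomposition of `K/A` -/

section LocalParts

variable {A : Type*} [CommRing A] [IsDedekindDomain A]

/-- A torsion element differs from a `v`-power torsion element by an element whose order is prime
to `v`. -/
theorem exists_mem_torsionBySet_smul_sub_eq_zero {M : Type*} [AddCommGroup M] [Module A M]
    (v : HeightOneSpectrum A) {x : M} {b : A} (hb : b ≠ 0) (hx : b • x = 0) :
    ∃ m : ℕ, 1 ≤ m ∧ ∃ z ∈ Submodule.torsionBySet A M ((v.asIdeal ^ m : Ideal A) : Set A),
      ∃ f ∉ v.asIdeal, f • (x - z) = 0 := by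
  have hfin : FiniteMultiplicity v.asIdeal (Ideal.span {b}) :=
    FiniteMultiplicity.of_prime_left v.prime (by simpa using hb)
  obtain ⟨J, hJ, hvJ⟩ := hfin.exists_eq_pow_mul_and_not_dvd
  set m := multiplicity v.asIdeal (Ideal.span {b})
  -- Here `(b) = v^m J` with `J` prime to `v`. The exponent `m + 1` replaces `m` so that it is at
  -- least `1`; the inclusion `v^(m+1) J ⊆ (b)` still holds.
  have hcop : IsCoprime (v.asIdeal ^ (m + 1)) J := by
    refine IsCoprime.pow_left ?_
    rw [Ideal.isCoprime_iff_sup_eq]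
    exact v.isMaximal.out.2 _ (left_lt_sup.2 fun h => hvJ (Ideal.dvd_iff_le.2 h))
  obtain ⟨e, he, f, hf, hef⟩ := Ideal.isCoprime_iff_exists.1 hcop
  have key : ∀ a ∈ v.asIdeal ^ (m + 1), (a * f) • x = 0 := fun a ha => by
    have h : a * f ∈ Ideal.span {b} := by
      rw [hJ]
      exact Ideal.mul_mem_mul (Ideal.pow_le_pow_right (Nat.le_succ m) ha) hf
    obtain ⟨c, hc⟩ := Ideal.mem_span_singleton'.1 h
    rw [← hc, mul_smul, hx, smul_zero]
  -- From `e + f = 1`, the element splits as `x = f • x + e • x`, where `v^(m+1)` kills `f • x` and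
  -- `f` kills `e • x`. Since `e ∈ v`, having `f ∈ v` as well would put `1` in `v`.
  refine ⟨m + 1, by omega, f • x, ?_, f, fun hfv => ?_, ?_⟩
  · rw [Submodule.mem_torsionBySet_iff]
    rintro ⟨a, ha⟩
    exact (smul_smul a f x).trans (key a ha)
  · refine v.isPrime.ne_top ((Ideal.eq_top_iff_one _).2 ?_)
    rw [← hef]
    exact add_mem (Ideal.pow_le_self (Nat.succ_ne_zero m) he) hfv
  · have h : x - f • x = e • x := by
      rw [sub_eq_iff_eq_add, ← add_smul, hef, one_smul]
    rw [h, smul_smul, mul_comm, key e he]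

variable {K : Type*} [Field K] [Algebra A K] [IsFractionRing A K]

theorem exists_smul_eq_zero_of_quotient_integers (x : K ⧸ integers A K) :
    ∃ b : A, b ≠ 0 ∧ b • x = 0 := by
  obtain ⟨y, rfl⟩ := Submodule.Quotient.mk_surjective _ x
  obtain ⟨⟨a, b⟩, h⟩ := IsLocalization.surj (nonZeroDivisors A) y
  refine ⟨b, nonZeroDivisors.ne_zero b.2, ?_⟩
  rw [← Submodule.Quotient.mk_smul, Submodule.Quotient.mk_eq_zero]
  exact ⟨a, by rw [Algebra.smul_def, mul_comm]; exact h.symm⟩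

theorem localPart_mk_eq_zero_iff (v : HeightOneSpectrum A) (y : K) :
    localPart K v (Submodule.Quotient.mk y) = 0 ↔ v.valuation K y ≤ 1 := by
  refine (Submodule.Quotient.mk_eq_zero _).trans ?_
  change algebraMap K (v.adicCompletion K) y ∈ v.adicCompletionIntegers K ↔ _
  rw [HeightOneSpectrum.algebraMap_adicCompletion, Function.comp_apply, Algebra.algebraMap_self,
    RingHom.id_apply, HeightOneSpectrum.mem_adicCompletionIntegers,
    HeightOneSpectrum.valuedAdicCompletion_eq_valuation']

/-- An element of `K/A` is determined by its local parts. -/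
theorem eq_zero_of_forall_localPart_eq_zero {x : K ⧸ integers A K}
    (h : ∀ v : HeightOneSpectrum A, localPart K v x = 0) : x = 0 := by
  obtain ⟨y, rfl⟩ := Submodule.Quotient.mk_surjective _ x
  rw [Submodule.Quotient.mk_eq_zero]
  exact HeightOneSpectrum.mem_integers_of_valuation_le_one K y
    fun v => (localPart_mk_eq_zero_iff v y).1 (h v)

/-- An `f` outside `v` has `v`-adic valuation `1`, so `f y ∈ A` forces `y` to be integral at `v`. -/
theorem localPart_eq_zero_of_smul_eq_zero {v : HeightOneSpectrum A} {x : K ⧸ integers A K} {f : A}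
    (hf : f ∉ v.asIdeal) (h : f • x = 0) : localPart K v x = 0 := by
  obtain ⟨y, rfl⟩ := Submodule.Quotient.mk_surjective _ x
  rw [← Submodule.Quotient.mk_smul, Submodule.Quotient.mk_eq_zero] at h
  obtain ⟨c, hc⟩ := h
  have hc' : algebraMap A K c = algebraMap A K f * y := by
    rw [← Algebra.smul_def]; exact hc
  rw [localPart_mk_eq_zero_iff]
  have := v.valuation_le_one (K := K) c
  change v.valuation K (algebraMap A K c) ≤ 1 at this
  rwa [hc', map_mul, (v.valuation_eq_one_iff_notMem (K := K)).2 hf, one_mul] at this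

/-- An element of `K/A` that is torsion for a power of `v` has no local part at `w ≠ v`. -/
theorem localPart_eq_zero_of_ne {v w : HeightOneSpectrum A} (hvw : w ≠ v)
    {x : K ⧸ integers A K} {m : ℕ}
    (hx : x ∈ Submodule.torsionBySet A (K ⧸ integers A K) ((v.asIdeal ^ m : Ideal A) : Set A)) :
    localPart K w x = 0 := by
  have hle : ¬ v.asIdeal ^ m ≤ w.asIdeal := fun h =>
    hvw (HeightOneSpectrum.ext (v.isMaximal.eq_of_le w.isPrime.ne_top
      (w.isPrime.le_of_pow_le h))).symm
  obtain ⟨f, hf, hfw⟩ := SetLike.not_le_iff_exists.1 hle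
  rw [Submodule.mem_torsionBySet_iff] at hx
  exact localPart_eq_zero_of_smul_eq_zero hfw (hx ⟨f, hf⟩)

/-- `K` is dense in `K_v` and `A_v` is open, so every coset of `A_v` meets `K`. -/
theorem localPart_surjective (v : HeightOneSpectrum A) : Function.Surjective (localPart K v) := by
  intro t
  obtain ⟨x, rfl⟩ := Submodule.Quotient.mk_surjective _ t
  have hopen : IsOpen {z : v.adicCompletion K | x - z ∈ v.adicCompletionIntegers K} :=
    (Valued.isOpen_valuationSubring (v.adicCompletion K)).preimage (by fun_prop)
  obtain ⟨y, hy⟩ := (HeightOneSpectrum.denseRange_algebraMap K v).exists_mem_open hopen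
    ⟨x, by simp⟩
  refine ⟨Submodule.Quotient.mk y, ?_⟩
  refine ((Submodule.Quotient.eq _).2 ?_).symm
  exact hy

/-- The submodule of elements of an `A`-module that are torsion for a power of `v`. -/
def powerTorsion (M : Type*) [AddCommGroup M] [Module A M] (v : HeightOneSpectrum A) :
    Submodule A M where
  carrier := {x | ∃ m : ℕ, 1 ≤ m ∧
    x ∈ Submodule.torsionBySet A M ((v.asIdeal ^ m : Ideal A) : Set A)}
  zero_mem' := ⟨1, le_rfl, zero_mem _⟩
  add_mem' := by
    rintro x y ⟨m, hm, hx⟩ ⟨m', _, hy⟩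
    refine ⟨m + m', by omega, add_mem ?_ ?_⟩
    · exact Submodule.torsionBySet_le_torsionBySet_pow m (m + m') (by omega) v.asIdeal hx
    · exact Submodule.torsionBySet_le_torsionBySet_pow m' (m + m') (by omega) v.asIdeal hy
  smul_mem' := by
    rintro a x ⟨m, hm, hx⟩
    exact ⟨m, hm, Submodule.smul_mem _ a hx⟩

/-- Injective because a `v`-power torsion element has no local part away from `v`, and the local
parts jointly determine it. Surjective because any lift to `K/A` can be replaced by its `v`-primary
component: the difference is killed by some `f ∉ v`, hence invisible at `v`. -/
theorem localPart_powerTorsion_bijective (v : HeightOneSpectrum A) :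
    Function.Bijective ((localPart K v).domRestrict (powerTorsion (K ⧸ integers A K) v)) := by
  constructor
  · rw [injective_iff_map_eq_zero]
    rintro ⟨x, m, hm, hx⟩ h
    refine Subtype.ext (eq_zero_of_forall_localPart_eq_zero fun w => ?_)
    obtain rfl | hw := eq_or_ne w v
    · exact h
    · exact localPart_eq_zero_of_ne hw hx
  · intro t
    obtain ⟨x, rfl⟩ := localPart_surjective v t
    obtain ⟨b, hb, hbx⟩ := exists_smul_eq_zero_of_quotient_integers x
    obtain ⟨m, hm, z, hz, f, hf, hfx⟩ := exists_mem_torsionBySet_smul_sub_eq_zero v hb hbx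
    refine ⟨⟨z, m, hm, hz⟩, ?_⟩
    have h := localPart_eq_zero_of_smul_eq_zero hf hfx
    rw [map_sub, sub_eq_zero] at h
    exact h.symm

variable (K) in
/-- The `v`-power torsion of `K/A` is `K_v/A_v`. -/
def powerTorsionEquiv (v : HeightOneSpectrum A) :
    powerTorsion (K ⧸ integers A K) v ≃ₗ[A] (v.adicCompletion K ⧸ localIntegers K v) :=
  LinearEquiv.ofBijective _ (localPart_powerTorsion_bijective v)

theorem localPart_powerTorsionEquiv_symm (v : HeightOneSpectrum A)
    (t : v.adicCompletion K ⧸ localIntegers K v) :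
    localPart K v ((powerTorsionEquiv K v).symm t : K ⧸ integers A K) = t :=
  (powerTorsionEquiv K v).apply_symm_apply t

theorem localPart_powerTorsionEquiv_symm_of_ne {v w : HeightOneSpectrum A} (h : w ≠ v)
    (t : v.adicCompletion K ⧸ localIntegers K v) :
    localPart K w ((powerTorsionEquiv K v).symm t : K ⧸ integers A K) = 0 := by
  obtain ⟨m, -, hm⟩ := ((powerTorsionEquiv K v).symm t).2
  exact localPart_eq_zero_of_ne h hm

theorem finite_support_powerTorsionEquiv_symm (x : K ⧸ integers A K) :
    (Function.support fun v : HeightOneSpectrum A =>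
      ((powerTorsionEquiv K v).symm (localPart K v x) : K ⧸ integers A K)).Finite :=
  (localPart_finite K x).subset fun v hv h => hv (by simp [h])

/-- An element of `K/A` is the sum of its primary components. -/
theorem finsum_powerTorsionEquiv_symm_localPart (x : K ⧸ integers A K) :
    ∑ᶠ v : HeightOneSpectrum A,
      ((powerTorsionEquiv K v).symm (localPart K v x) : K ⧸ integers A K) = x := by
  -- Local parts separate the elements of `K/A`, and at `w` only the `w`-th term of the sum
  -- survives.
  rw [← sub_eq_zero]
  refine eq_zero_of_forall_localPart_eq_zero fun w => ?_
  rw [map_sub, sub_eq_zero]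
  change (localPart K w).toAddMonoidHom _ = _
  rw [AddMonoidHom.map_finsum _ (finite_support_powerTorsionEquiv_symm x)]
  refine (finsum_eq_single _ w fun v hv => ?_).trans (localPart_powerTorsionEquiv_symm w _)
  exact localPart_powerTorsionEquiv_symm_of_ne hv.symm _

end LocalParts

/-! ### Tate modules, level structures and isogenies -/

section Moduli

variable {k : Type*} [Field k] [Fintype k]
  {K : Type*} [Field K] [Algebra k K] {pt : Place K}
  {A : Type*} [CommRing A] [IsDedekindDomain A] [Algebra k A] [Algebra A K] [IsFractionRing A K]
  {F : Type*} [Field F] [Algebra k F] [Algebra A F] {n : ℕ}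
  {Ω : Type*} [Field Ω] [Algebra k Ω] [Algebra F Ω]

theorem AdelicTateModule.toHom_apply {Φ : DrinfeldModule k pt A F n} (ζ : AdelicTateModule Ω Φ)
    (x : K ⧸ integers A K) :
    AdelicTateModule.toHom ζ x =
      ∑ᶠ v : HeightOneSpectrum A, (ζ v (localPart K v x) : Φ.Points Ω) :=
  rfl

/-- Restricting to the `v`-primary part of `K/A` recovers `ζ_v`; injectivity of `toHom` follows. -/
theorem AdelicTateModule.toHom_powerTorsionEquiv_symm {Φ : DrinfeldModule k pt A F n}
    (ζ : AdelicTateModule Ω Φ) (v : HeightOneSpectrum A)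
    (t : v.adicCompletion K ⧸ localIntegers K v) :
    AdelicTateModule.toHom ζ ((powerTorsionEquiv K v).symm t : K ⧸ integers A K) = ζ v t := by
  rw [AdelicTateModule.toHom_apply, finsum_eq_single _ v fun w hw => by
    rw [localPart_powerTorsionEquiv_symm_of_ne hw, map_zero, ZeroMemClass.coe_zero],
    localPart_powerTorsionEquiv_symm]

/-- The point of the adelic Tate module given by the primary components of a homomorphism
`K/A → Φ(Ω)`. -/
def AdelicTateModule.ofHom {Φ : DrinfeldModule k pt A F n}
    (ρ : (K ⧸ integers A K) →ₗ[A] Φ.Points Ω) : AdelicTateModule Ω Φ := fun v =>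
  (ρ.restrict (p := powerTorsion (K ⧸ integers A K) v) (q := Φ.primaryTorsion Ω v) (by
    rintro x ⟨m, hm, hx⟩
    refine ⟨m, hm, ?_⟩
    rw [DrinfeldModule.torsion, Submodule.mem_torsionBySet_iff]
    rw [Submodule.mem_torsionBySet_iff] at hx
    intro a
    rw [← map_smul, hx a, map_zero])).comp (powerTorsionEquiv K v).symm.toLinearMap

theorem AdelicTateModule.toHom_ofHom {Φ : DrinfeldModule k pt A F n}
    (ρ : (K ⧸ integers A K) →ₗ[A] Φ.Points Ω) :
    AdelicTateModule.toHom (AdelicTateModule.ofHom ρ) = ρ := by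
  refine LinearMap.ext fun x => ?_
  conv_rhs => rw [← finsum_powerTorsionEquiv_symm_localPart x]
  exact (AddMonoidHom.map_finsum ρ.toAddMonoidHom
    (finite_support_powerTorsionEquiv_symm x)).symm

theorem AdelicTateModule.toHom_bijective (Φ : DrinfeldModule k pt A F n) :
    Function.Bijective (AdelicTateModule.toHom : AdelicTateModule Ω Φ → _) := by
  refine ⟨fun ζ η h => ?_, fun ρ => ⟨_, AdelicTateModule.toHom_ofHom ρ⟩⟩
  funext v
  refine LinearMap.ext fun t => Subtype.ext ?_
  rw [← AdelicTateModule.toHom_powerTorsionEquiv_symm, h,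
    AdelicTateModule.toHom_powerTorsionEquiv_symm]

theorem AdelicTateModule.toHom_onTate {Φ Ψ : DrinfeldModule k pt A F n}
    (P : DrinfeldModule.Isogeny Φ Ψ) (ζ : AdelicTateModule Ω Φ) :
    AdelicTateModule.toHom (fun v => P.onTate Ω v (ζ v)) =
      (P.onPoints Ω).comp (AdelicTateModule.toHom ζ) := by
  refine LinearMap.ext fun x => ?_
  exact (AddMonoidHom.map_finsum (P.onPoints Ω).toAddMonoidHom
    ((localPart_finite K x).subset fun v hv h => hv (by simp [h]))).symm

/-- A homomorphism out of a finite direct sum is determined by its restrictions to the summands,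
which reduces questions about `n` points to one point at a time. -/
theorem AdelicTateModule.sum_toHom_comp_proj_eq_iff {Φ : DrinfeldModule k pt A F n}
    (ζ : Fin n → AdelicTateModule Ω Φ) (ρ : (Fin n → K ⧸ integers A K) →ₗ[A] Φ.Points Ω) :
    ∑ i, (AdelicTateModule.toHom (ζ i)).comp (LinearMap.proj i) = ρ ↔
      ∀ i, AdelicTateModule.toHom (ζ i) =
        ρ.comp (LinearMap.single A (fun _ : Fin n => K ⧸ integers A K) i) := by
  have h : ∑ i, (AdelicTateModule.toHom (ζ i)).comp (LinearMap.proj i) =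
      LinearMap.lsum A (fun _ : Fin n => K ⧸ integers A K) A
        fun i => AdelicTateModule.toHom (ζ i) := rfl
  rw [h, ← LinearEquiv.eq_symm_apply, funext_iff]
  rfl

namespace PointedDrinfeldModule

theorem toLevel_bijective : Function.Bijective
    (fun X : PointedDrinfeldModule k pt A F n Ω => X.toLevel) := by
  constructor
  · rintro ⟨Φ, ζ⟩ ⟨Ψ, η⟩ h
    obtain rfl : Φ = Ψ := congrArg LevelDrinfeldModule.module h
    have h' : ∑ i, (AdelicTateModule.toHom (ζ i)).comp (LinearMap.proj i) =
        ∑ i, (AdelicTateModule.toHom (η i)).comp (LinearMap.proj i) := by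
      injection h
    rw [AdelicTateModule.sum_toHom_comp_proj_eq_iff] at h'
    have : ζ = η := funext fun i => (AdelicTateModule.toHom_bijective Φ).1
      ((h' i).trans ((AdelicTateModule.sum_toHom_comp_proj_eq_iff η _).1 rfl i).symm)
    rw [this]
  · rintro ⟨Φ, ρ⟩
    exact ⟨⟨Φ, fun i => AdelicTateModule.ofHom
        (ρ.comp (LinearMap.single A (fun _ : Fin n => K ⧸ integers A K) i))⟩,
      congrArg (LevelDrinfeldModule.mk Φ) ((AdelicTateModule.sum_toHom_comp_proj_eq_iff _ _).2
        fun _ => AdelicTateModule.toHom_ofHom _)⟩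

theorem related_iff_toLevel_related (X Y : PointedDrinfeldModule k pt A F n Ω) :
    X.Related Y ↔ X.toLevel.Related Y.toLevel := by
  refine exists_congr fun P => ?_
  let ρ : (Fin n → K ⧸ integers A K) →ₗ[A] X.module.Points Ω :=
    ∑ i, (AdelicTateModule.toHom (X.point i)).comp (LinearMap.proj i)
  have hρ := (AdelicTateModule.sum_toHom_comp_proj_eq_iff X.point ρ).1 rfl
  refine Iff.trans ?_ (AdelicTateModule.sum_toHom_comp_proj_eq_iff Y.point
    ((P.onPoints Ω).comp ρ)).symm
  refine forall_congr' fun i => ?_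
  -- On the `i`-th summand both sides are now values of `toHom`, so its injectivity turns the
  -- equation into one in the Tate modules, place by place.
  rw [LinearMap.comp_assoc, ← hρ, ← AdelicTateModule.toHom_onTate,
    (AdelicTateModule.toHom_bijective Y.module).1.eq_iff, funext_iff]

end PointedDrinfeldModule

end Moduli

/-- An equivalence compatible with two relations is compatible with the equivalence relations they
generate. -/
theorem eqvGen_iff_of_equiv {α β : Type*} {r : α → α → Prop} {s : β → β → Prop} (e : α ≃ β)
    (h : ∀ a b, r a b ↔ s (e a) (e b)) (a b : α) :
    Relation.EqvGen r a b ↔ Relation.EqvGen s (e a) (e b) := by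
  constructor
  · intro hab
    induction hab with
    | rel a b hab => exact .rel _ _ ((h a b).1 hab)
    | refl a => exact .refl _
    | symm a b _ ih => exact .symm _ _ ih
    | trans a b c _ _ ih ih' => exact .trans _ _ _ ih ih'
  · suffices ∀ c d, Relation.EqvGen s c d → Relation.EqvGen r (e.symm c) (e.symm d) from
      fun hab => by simpa using this _ _ hab
    intro c d hcd
    induction hcd with
    | rel c d hcd => exact .rel _ _ ((h _ _).2 (by simpa using hcd))
    | refl c => exact .refl _
    | symm c d _ ih => exact .symm _ _ ih
    | trans c d f _ _ ih ih' => exact .trans _ _ _ ih ih'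

end

end Drinfeld

theorem corollary2p6
    {k : Type*} [Field k] [Fintype k]
    {K : Type*} [Field K] [Algebra k K] (hK : Drinfeld.IsCurveFunctionField k K)
    (pt : Drinfeld.Place K)
    {A : Type*} [CommRing A] [IsDedekindDomain A] [Algebra k A] [Algebra A K]
    [IsScalarTower k A K] [IsFractionRing A K] (hA : Drinfeld.IsRegularOutside pt A)
    {F : Type*} [Field F] [Algebra k F] [Algebra A F] [IsScalarTower k A F]
    (hF : Function.Injective (algebraMap A F))
    {Ω : Type*} [Field Ω] [Algebra k Ω] [Algebra F Ω] [IsScalarTower k F Ω] [IsAlgClosure F Ω]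
    (n : ℕ) :
    (Function.Bijective (fun X : Drinfeld.PointedDrinfeldModule k pt A F n Ω => X.toLevel)) ∧
    (∀ X Y : Drinfeld.PointedDrinfeldModule k pt A F n Ω,
      X.Related Y ↔ X.toLevel.Related Y.toLevel) ∧
    (∃ e : Drinfeld.CommensurabilityClasses k pt A F n Ω ≃
        Drinfeld.LevelIsogenyClasses k pt A F n Ω,
      ∀ X : Drinfeld.PointedDrinfeldModule k pt A F n Ω, e X.toClass = X.toLevel.toClass) := by
  have hbij := Drinfeld.PointedDrinfeldModule.toLevel_bijective
    (k := k) (pt := pt) (A := A) (F := F) (n := n) (Ω := Ω)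
  have hrel := Drinfeld.PointedDrinfeldModule.related_iff_toLevel_related
    (k := k) (pt := pt) (A := A) (F := F) (n := n) (Ω := Ω)
  exact ⟨hbij, hrel, Quotient.congr (Equiv.ofBijective _ hbij)
    (Drinfeld.eqvGen_iff_of_equiv _ hrel), fun _ => rfl⟩
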